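/- Let $X$ be a real Banach space with continuous dual $X^*$ and pairing $\langle\cdot,\cdot\rangle$. For a set-valued operator $A\colon X\rightrightarrows X^*$, let $\operatorname{gra}A=\{(x,x^*)\in X\times X^* : x^*\in Ax\}$ and $\operatorname{dom}A=\{x\in X : Ax\neq\varnothing\}$. The operator $A$ is monotone if $\langle x-y,x^*-y^*\rangle\ge 0$ for all $(x,x^*),(y,y^*)\in\operatorname{gra}A$. It is maximal monotone if it is monotone and every monotone operator $B\colon X\rightrightarrows X^*$ with $\operatorname{gra}A\subseteq\operatorname{gra}B$ satisfies $\operatorname{gra}B=\operatorname{gra}A$. It is a linear relation if $\operatorname{gra}A$ is a linear subspace of $X\times X^*$. For $C\subseteq X$, the normal cone operator $N_C\colon X\rightrightarrows X^*$ is given by $N_C(x)=\{x^*\in X^* : \langle c-x,x^*\rangle\le 0\text{ for all }c\in C\}$ if $x\in C$, and $N_C(x)=\varnothing$ if $x\notin C$. The sum of two operators $A,B\colon X\rightrightarrows X^*$ is given by $(A+B)x=\{a^*+b^* : a^*\in Ax,\ b^*\in Bx\}$. Theorem. Let $A\colon X\rightrightarrows X^*$ be a maximal monotone linear relation, let $C$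 be a nonempty closed convex subset of $X$, and suppose that $\operatorname{dom}A\cap\operatorname{int}C\neq\varnothing$. Then $A+N_C$ is maximal monotone. -/

import Mathlib

/-- A set-valued operator from a real normed space `X` to its continuous dual `X*`. -/
abbrev SetValuedOp (X : Type*) [NormedAddCommGroup X] [NormedSpace ℝ X] :=
  X → Set (StrongDual ℝ X)

namespace SetValuedOp

variable {X : Type*} [NormedAddCommGroup X] [NormedSpace ℝ X]

/-- The graph of a set-valued operator. -/
def graph (A : SetValuedOp X) : Set (X × StrongDual ℝ X) :=
  {p | p.2 ∈ A p.1}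

/-- The domain of a set-valued operator: the points with nonempty value. -/
def dom (A : SetValuedOp X) : Set X :=
  {x | (A x).Nonempty}

/-- Monotonicity: `⟨x - y, x* - y*⟩ ≥ 0` for all `(x, x*)`, `(y, y*)` in the graph. -/
def IsMonotone (A : SetValuedOp X) : Prop :=
  ∀ p ∈ A.graph, ∀ q ∈ A.graph, 0 ≤ (p.2 - q.2) (p.1 - q.1)

/-- Maximal monotonicity: monotone, and no proper enlargement of the graph is monotone. -/
def IsMaximalMonotone (A : SetValuedOp X) : Prop :=
  A.IsMonotone ∧ ∀ B : SetValuedOp X, B.IsMonotone → A.graph ⊆ B.graph → B.graph = A.graph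

/-- A linear relation: the graph is a linear subspace of `X × X*`. -/
def IsLinearRelation (A : SetValuedOp X) : Prop :=
  ∃ S : Submodule ℝ (X × StrongDual ℝ X), (S : Set (X × StrongDual ℝ X)) = A.graph

/-- The sum operator `x ↦ A x + B x`. -/
def sum (A B : SetValuedOp X) : SetValuedOp X :=
  fun x => {s | ∃ a ∈ A x, ∃ b ∈ B x, s = a + b}

/-- The normal cone operator of `C`: at `x ∈ C` it consists of the functionals `x*` with
`⟨c - x, x*⟩ ≤ 0` for all `c ∈ C`; at `x ∉ C` it is empty. -/
def normalCone (C : Set X) : SetValuedOp X :=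
  fun x => {f | x ∈ C ∧ ∀ c ∈ C, f (c - x) ≤ 0}

end SetValuedOp

open Set

namespace SetValuedOp

variable {X : Type*} [NormedAddCommGroup X] [NormedSpace ℝ X]

/-! Let `(z, z')` be monotonically related to the graph of `A + N_C`. Maximality lets functionals
vanishing on `dom A` be added to values of `A`, which forces `z` into the closure of `dom A`. If `z
∉ C`, `exists_normalCone_pos` gives a normal `n` at some `p ∈ C ∩ dom A` with `n (z - p) > 0`; large
multiples of `n` contradict the relation. For `z ∈ C`, the function `(z' - x') (z - x)` is convex on
the linear graph of `A` and nonnegative over `C`. Hahn–Banach yields `f` with `f (c - x) ≤ (z' - x')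
(z - x)` on the graph, for all `c ∈ C`. Taking `c = z` gives `z' - f ∈ A z` by maximality; then `(x,
x') = (z, z' - f)` gives `f ∈ N_C(z)`. -/

/-- The segment from an interior point of a closed set to a point outside the set
leaves the set at a point which is not interior. -/
theorem exists_exit_point {C : Set X} (hC : IsClosed C) {x w : X} (hx : x ∈ interior C)
    (hw : w ∉ C) :
    ∃ t : ℝ, 0 ≤ t ∧ t < 1 ∧ x + t • (w - x) ∈ C ∧ x + t • (w - x) ∉ interior C := by
  have hγ : Continuous fun t : ℝ => x + t • (w - x) := by fun_prop
  have hK : IsCompact (Icc (0 : ℝ) 1 ∩ (fun t : ℝ => x + t • (w - x)) ⁻¹' C) :=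
    isCompact_Icc.inter_right (hC.preimage hγ)
  obtain ⟨t, ⟨⟨ht0, ht1⟩, htC⟩, hmax⟩ :=
    hK.exists_isGreatest ⟨0, by simp, by simpa using interior_subset hx⟩
  have ht1' : t < 1 := by
    refine lt_of_le_of_ne ht1 ?_
    rintro rfl
    exact hw (by simpa using htC)
  refine ⟨t, ht0, ht1', htC, fun hint => ?_⟩
  have hnhds : (fun t : ℝ => x + t • (w - x)) ⁻¹' interior C ∈ nhds t :=
    (isOpen_interior.preimage hγ).mem_nhds hint
  obtain ⟨l, s, ⟨hlt, hts⟩, hsub⟩ := mem_nhds_iff_exists_Ioo_subset.1 hnhds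
  obtain ⟨r, htr, hr⟩ := exists_between (lt_min hts ht1')
  have hrC : x + r • (w - x) ∈ interior C :=
    hsub ⟨hlt.trans htr, hr.trans_le (min_le_left _ _)⟩
  exact absurd (hmax ⟨⟨ht0.trans htr.le, (hr.trans_le (min_le_right _ _)).le⟩,
    interior_subset (s := C) hrC⟩) (not_le.2 htr)

/-- A functional bounded by `a` on the interior of a convex set with nonempty interior
is bounded by `a` on the set. -/
theorem le_of_le_on_interior {C : Set X} (hconv : Convex ℝ C) (hint : (interior C).Nonempty)
    {f : StrongDual ℝ X} {a : ℝ} (h : ∀ c ∈ interior C, f c ≤ a) {c : X} (hc : c ∈ C) :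
    f c ≤ a := by
  have hsub : closure (interior C) ⊆ {y | f y ≤ a} :=
    closure_minimal h (isClosed_le f.continuous continuous_const)
  rw [hconv.closure_interior_eq_closure_of_nonempty_interior hint] at hsub
  exact hsub (subset_closure hc)

/-- A point of the closure of a subspace `D` outside a closed convex set `C`, where `D` meets the
interior of `C`, is strictly separated from `C` by a normal vector at a point of `C ∩ D`. -/
theorem exists_normalCone_pos {C : Set X} (hC : IsClosed C) (hconv : Convex ℝ C)
    (D : Submodule ℝ X) {x z : X} (hxD : x ∈ D) (hx : x ∈ interior C)
    (hz : z ∈ closure (D : Set X)) (hzC : z ∉ C) :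
    ∃ p ∈ D, ∃ n ∈ normalCone C p, 0 < n (z - p) := by
  obtain ⟨d, hd, hdC⟩ := Metric.isOpen_iff.1 hC.isOpen_compl z hzC
  obtain ⟨δ, hδ, hδC⟩ := Metric.isOpen_iff.1 isOpen_interior x hx
  have hM : 0 < ‖z - x‖ + 1 := by positivity
  -- The three bounds serve, in order, to keep `w` outside `C`, to bound `‖w - x‖`, and to make
  -- `hball` hold.
  obtain ⟨w, hwD, hw⟩ := Metric.mem_closure_iff.1 hz
    (min (d / 2) (min 1 (δ * (d / 2 / (‖z - x‖ + 1))))) (by positivity)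
  rw [dist_eq_norm, lt_min_iff, lt_min_iff] at hw
  obtain ⟨hw1, hw2, hw3⟩ := hw
  have hfar : ∀ c ∈ C, d ≤ ‖z - c‖ := by
    intro c hc
    by_contra! h
    exact hdC (by rwa [mem_ball_iff_norm']) hc
  have hwC : w ∉ C := fun h => by linarith [hfar w h]
  obtain ⟨t, ht0, ht1, hpC, hpint⟩ := exists_exit_point hC hx hwC
  obtain ⟨n, hn⟩ := geometric_hahn_banach_open_point hconv.interior isOpen_interior hpint
  refine ⟨x + t • (w - x), D.add_mem hxD (D.smul_mem _ (D.sub_mem hwD hxD)), n, ⟨hpC, ?_⟩, ?_⟩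
  · intro c hc
    rw [map_sub, sub_nonpos]
    exact le_of_le_on_interior hconv ⟨x, hx⟩ (fun c hc => (hn c hc).le) hc
  have ht : 0 < 1 - t := by linarith
  -- The exit point is at distance at least `d` from `z`, so `1 - t` has a lower bound independent
  -- of `w`.
  have hgap : d / 2 / (‖z - x‖ + 1) ≤ 1 - t := by
    rw [div_le_iff₀ hM]
    have h1 : ‖z - (x + t • (w - x))‖ ≤ ‖z - w‖ + (1 - t) * ‖w - x‖ := by
      have : z - (x + t • (w - x)) = (z - w) + (1 - t) • (w - x) := by module
      rw [this, ← abs_of_pos ht, ← Real.norm_eq_abs, ← norm_smul, Real.norm_eq_abs,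
        abs_of_pos ht]
      exact norm_add_le _ _
    have h2 : ‖w - x‖ ≤ ‖z - x‖ + 1 := by
      have : w - x = (z - x) - (z - w) := by abel
      rw [this]
      exact (norm_sub_le _ _).trans (by linarith)
    have h3 := mul_le_mul_of_nonneg_left h2 ht.le
    linarith [hfar _ hpC]
  -- Separating this shifted point gives `n (z - w) > -(1 - t) * t * n (w - x)`, so the error `z -
  -- w` cannot cancel the gain `(1 - t) * n (w - x)`.
  have hball : x - (1 - t)⁻¹ • (z - w) ∈ interior C := by
    apply hδC
    rw [mem_ball_iff_norm, sub_sub_cancel_left, norm_neg, norm_smul, norm_inv, Real.norm_eq_abs,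
      abs_of_pos ht, inv_mul_lt_iff₀ ht, mul_comm]
    exact hw3.trans_le (mul_le_mul_of_nonneg_left hgap hδ.le)
  have hnx := hn x hx
  have hnb := hn _ hball
  simp only [map_add, map_sub, map_smul, smul_eq_mul] at hnx hnb ⊢
  have hv : 0 < n w - n x := pos_of_mul_pos_right (by linarith) ht0
  have hmul : 0 < (1 - t) * (t * (n w - n x) + (1 - t)⁻¹ * (n z - n w)) :=
    mul_pos ht (by linarith)
  have hcancel : (1 - t) * (t * (n w - n x) + (1 - t)⁻¹ * (n z - n w))
      = (1 - t) * (t * (n w - n x)) + (n z - n w) := by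
    field_simp
  have hsq : 0 < (1 - t) * ((1 - t) * (n w - n x)) := by positivity
  linarith

/-- A continuous functional vanishing on a subspace `D` but not at a point outside its closure. -/
theorem exists_vanishing_functional (D : Submodule ℝ X) {z : X} (hz : z ∉ closure (D : Set X)) :
    ∃ f : StrongDual ℝ X, (∀ x ∈ D, f x = 0) ∧ f z ≠ 0 := by
  obtain ⟨f, u, hfD, hfz⟩ :=
    geometric_hahn_banach_closed_point D.convex.closure isClosed_closure hz
  have hu : 0 < u := by simpa using hfD 0 (subset_closure D.zero_mem)
  refine ⟨f, fun x hx => ?_, (hu.trans hfz).ne'⟩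
  by_contra h
  have := hfD ((u / f x) • x) (subset_closure (D.smul_mem _ hx))
  rw [map_smul, smul_eq_mul, div_mul_cancel₀ _ h] at this
  exact lt_irrefl _ this

/-- A real number `a` with `0 ≤ a - r * b` for all `r ≥ 0` forces `b ≤ 0`. -/
theorem nonpos_of_forall_nonneg_sub_mul {a b : ℝ} (h : ∀ r : ℝ, 0 ≤ r → 0 ≤ a - r * b) :
    b ≤ 0 := by
  by_contra! hb
  have := h ((|a| + 1) / b) (by positivity)
  rw [div_mul_cancel₀ _ hb.ne'] at this
  linarith [le_abs_self a]

/-- A point monotonically related to the graph of a maximal monotone operator is in the graph. -/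
theorem IsMaximalMonotone.mem_of_monotonically_related {A : SetValuedOp X}
    (hA : A.IsMaximalMonotone) {z : X} {z' : StrongDual ℝ X}
    (h : ∀ x, ∀ x' ∈ A x, 0 ≤ (z' - x') (z - x)) : z' ∈ A z := by
  let B : SetValuedOp X := fun x => {x' | x' ∈ A x ∨ (x = z ∧ x' = z')}
  have hB : B.IsMonotone := by
    rintro ⟨x, x'⟩ hx ⟨y, y'⟩ hy
    rcases hx with hx | ⟨rfl, rfl⟩ <;> rcases hy with hy | ⟨rfl, rfl⟩
    · exact hA.1 (x, x') hx (y, y') hy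
    · have := h x x' hx
      rw [← neg_sub, ← neg_sub x, map_neg, neg_apply, neg_neg] at this
      exact this
    · exact h y y' hy
    · simp
  have hmem : (z, z') ∈ B.graph := Or.inr ⟨rfl, rfl⟩
  rw [hA.2 B hB fun p hp => Or.inl hp] at hmem
  exact hmem

/-- A monotone operator containing every point monotonically related to its graph is maximal. -/
theorem IsMonotone.isMaximalMonotone {A : SetValuedOp X} (hA : A.IsMonotone)
    (h : ∀ z z', (∀ x, ∀ x' ∈ A x, 0 ≤ (z' - x') (z - x)) → z' ∈ A z) :
    A.IsMaximalMonotone :=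
  ⟨hA, fun _ hB hAB => Subset.antisymm
    (fun p hp => h p.1 p.2 fun x x' hx => hB p hp (x, x') (hAB hx)) hAB⟩

theorem normalCone_isMonotone (C : Set X) : (normalCone C).IsMonotone := by
  rintro ⟨x, f⟩ ⟨hx, hf⟩ ⟨y, g⟩ ⟨hy, hg⟩
  have h1 := hf y hy
  have h2 := hg x hx
  simp only [sub_apply, map_sub] at h1 h2 ⊢
  linarith

theorem IsMonotone.sum {A B : SetValuedOp X} (hA : A.IsMonotone) (hB : B.IsMonotone) :
    (A.sum B).IsMonotone := by
  rintro ⟨x, _⟩ ⟨a, ha, b, hb, rfl⟩ ⟨y, _⟩ ⟨a', ha', b', hb', rfl⟩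
  have h1 := hA (x, a) ha (y, a') ha'
  have h2 := hB (x, b) hb (y, b') hb'
  simp only [sub_apply, add_apply] at h1 h2 ⊢
  linarith

/-- The function `(x, x') ↦ (z' - x') (z - x)` is convex along segments between monotonically
related points. -/
theorem sub_apply_sub_convexCombo_le {x y z : X} {x' y' z' : StrongDual ℝ X}
    (h : 0 ≤ (x' - y') (x - y)) {a b : ℝ} (ha : 0 ≤ a) (hb : 0 ≤ b) (hab : a + b = 1) :
    (z' - (a • x' + b • y')) (z - (a • x + b • y))
      ≤ a * (z' - x') (z - x) + b * (z' - y') (z - y) := by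
  -- The two sides of the goal differ by exactly `a * b * (x' - y') (x - y)`.
  have h := mul_nonneg (mul_nonneg ha hb) h
  obtain rfl : b = 1 - a := by linarith
  simp only [map_sub, map_add, map_smul, smul_eq_mul, sub_apply, add_apply, smul_apply] at h ⊢
  linarith

/-- A continuous functional on `X × ℝ` splits into its two components. -/
theorem exists_apply_eq_add_mul (F : StrongDual ℝ (X × ℝ)) :
    ∃ (φ : StrongDual ℝ X) (α : ℝ), ∀ x r, F (x, r) = φ x + r * α := by
  refine ⟨F.comp (ContinuousLinearMap.inl ℝ X ℝ), F (0, 1), fun x r => ?_⟩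
  have : ((x, r) : X × ℝ) = (x, 0) + r • ((0 : X), (1 : ℝ)) := by simp
  rw [this, map_add, map_smul, smul_eq_mul]
  rfl

/-- If the convex function `(x, x') ↦ (z' - x') (z - x)` on a monotone linear relation is
nonnegative over `C`, whose interior meets the domain, then it dominates the supremum over `c ∈ C`
of `f (c - x)` for some continuous functional `f`. -/
theorem exists_separating_functional {S : Submodule ℝ (X × StrongDual ℝ X)}
    (hS : ∀ p ∈ S, 0 ≤ p.2 p.1) {C : Set X} (hconv : Convex ℝ C)
    {p₀ : X × StrongDual ℝ X} (hp₀ : p₀ ∈ S) (hp₀C : p₀.1 ∈ interior C)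
    {z : X} {z' : StrongDual ℝ X}
    (h : ∀ p ∈ S, p.1 ∈ C → 0 ≤ (z' - p.2) (z - p.1)) :
    ∃ f : StrongDual ℝ X, ∀ p ∈ S, ∀ c ∈ C, f (c - p.1) ≤ (z' - p.2) (z - p.1) := by
  -- Projecting the epigraph to `X × ℝ` forgets `x'`, so that the separating functional involves
  -- only `X`.
  let V : Set (X × ℝ) := {v | ∃ p ∈ S, p.1 = v.1 ∧ (z' - p.2) (z - p.1) ≤ v.2}
  have hV : Convex ℝ V := by
    rintro ⟨_, r⟩ ⟨p, hp, rfl, hpr⟩ ⟨_, s⟩ ⟨q, hq, rfl, hqs⟩ a b ha hb hab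
    refine ⟨a • p + b • q, S.add_mem (S.smul_mem _ hp) (S.smul_mem _ hq), rfl, ?_⟩
    exact (sub_apply_sub_convexCombo_le (hS _ (S.sub_mem hp hq)) ha hb hab).trans
      (add_le_add (mul_le_mul_of_nonneg_left hpr ha) (mul_le_mul_of_nonneg_left hqs hb))
  have hdisj : Disjoint (interior C ×ˢ Iio (0 : ℝ)) V := by
    rw [Set.disjoint_left]
    rintro ⟨_, r⟩ ⟨hc, hr⟩ ⟨p, hp, rfl, hpr⟩
    have := h p hp (interior_subset hc)
    exact absurd (lt_of_le_of_lt (this.trans hpr) hr) (lt_irrefl _)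
  have hUconv : Convex ℝ (interior C ×ˢ Iio (0 : ℝ)) := hconv.interior.prod (convex_Iio 0)
  have hUopen : IsOpen (interior C ×ˢ Iio (0 : ℝ)) := isOpen_interior.prod isOpen_Iio
  obtain ⟨F, u, hFU, hFV⟩ := geometric_hahn_banach_open hUconv hUopen hV hdisj
  obtain ⟨φ, α, hF⟩ := exists_apply_eq_add_mul F
  have hU : ∀ c ∈ interior C, ∀ r < 0, φ c + r * α < u := fun c hc r hr => by
    rw [← hF]; exact hFU (c, r) ⟨hc, hr⟩
  have hVle : ∀ p ∈ S, ∀ r, (z' - p.2) (z - p.1) ≤ r → u ≤ φ p.1 + r * α := fun p hp r hr => by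
    rw [← hF]; exact hFV (p.1, r) ⟨p, hp, rfl, hr⟩
  -- The hyperplane is not vertical: both separated sets have points over `p₀.1`.
  have hα0 : 0 < α := by
    have h1 := hU p₀.1 hp₀C (-1) (by norm_num)
    have h2 := hVle p₀ hp₀ _ le_rfl
    have h3 := h p₀ hp₀ (interior_subset hp₀C)
    have h4 : 0 < ((z' - p₀.2) (z - p₀.1) + 1) * α := by linarith
    exact pos_of_mul_pos_right h4 (by linarith)
  have hUle : ∀ c ∈ C, φ c ≤ u := by
    refine fun c hc => le_of_le_on_interior hconv ⟨_, hp₀C⟩ (fun c hc => ?_) hc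
    refine le_of_forall_pos_le_add fun ε hε => ?_
    have := hU c hc (-(ε / α)) (by have := div_pos hε hα0; linarith)
    rw [neg_mul, div_mul_cancel₀ _ hα0.ne'] at this
    linarith
  refine ⟨α⁻¹ • φ, fun p hp c hc => ?_⟩
  have h1 := hUle c hc
  have h2 := hVle p hp _ le_rfl
  rw [smul_apply, smul_eq_mul, inv_mul_le_iff₀ hα0, map_sub]
  linarith

/-- A point whose first coordinate lies in `C` and which is monotonically related to the part of a
maximal monotone linear relation over `C` is in the graph of the sum with the normal cone. -/
theorem mem_sum_normalCone_of_mem {A : SetValuedOp X} (hA : A.IsMaximalMonotone)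
    {S : Submodule ℝ (X × StrongDual ℝ X)} (hS : (S : Set (X × StrongDual ℝ X)) = A.graph)
    {C : Set X} (hconv : Convex ℝ C) {p₀ : X × StrongDual ℝ X} (hp₀ : p₀ ∈ S)
    (hp₀C : p₀.1 ∈ interior C) {z : X} {z' : StrongDual ℝ X} (hz : z ∈ C)
    (h : ∀ p ∈ S, p.1 ∈ C → 0 ≤ (z' - p.2) (z - p.1)) :
    z' ∈ A.sum (normalCone C) z := by
  have hmem : ∀ p, p ∈ S ↔ p ∈ A.graph := fun p => by rw [← hS]; rfl
  have hpos : ∀ p ∈ S, 0 ≤ p.2 p.1 := fun p hp => by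
    simpa using hA.1 p ((hmem p).1 hp) 0 ((hmem 0).1 S.zero_mem)
  obtain ⟨f, hf⟩ := exists_separating_functional hpos hconv hp₀ hp₀C h
  have hzA : z' - f ∈ A z := hA.mem_of_monotonically_related fun x x' hx => by
    have := hf (x, x') ((hmem _).2 hx) z hz
    simp only [sub_apply] at this ⊢
    linarith
  refine ⟨z' - f, hzA, f, ⟨hz, fun c hc => ?_⟩, by abel⟩
  simpa using hf (z, z' - f) ((hmem _).2 hzA) c hc

/-- Functionals vanishing on the domain can be added to the values of a maximal monotone
operator. -/
theorem IsMaximalMonotone.add_mem_of_vanishing {A : SetValuedOp X} (hA : A.IsMaximalMonotone)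
    {f : StrongDual ℝ X} (hf : ∀ x ∈ A.dom, f x = 0) {x : X} {x' : StrongDual ℝ X}
    (hx : x' ∈ A x) : x' + f ∈ A x := by
  refine hA.mem_of_monotonically_related fun y y' hy => ?_
  have h1 := hA.1 (x, x') hx (y, y') hy
  have h2 := hf x ⟨x', hx⟩
  have h3 := hf y ⟨y', hy⟩
  simp only [sub_apply, add_apply, map_sub] at h1 ⊢
  linarith

end SetValuedOp

open SetValuedOp in
theorem theorem3p1 {X : Type*} [NormedAddCommGroup X] [NormedSpace ℝ X] [CompleteSpace X]
    (A : SetValuedOp X) (hA : A.IsMaximalMonotone) (hlin : A.IsLinearRelation)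
    (C : Set X) (hCne : C.Nonempty) (hCclosed : IsClosed C) (hCconv : Convex ℝ C)
    (hAC : (A.dom ∩ interior C).Nonempty) :
    (A.sum (SetValuedOp.normalCone C)).IsMaximalMonotone := by
  obtain ⟨S, hS⟩ := hlin
  obtain ⟨x₀, ⟨x₀', hx₀⟩, hx₀C⟩ := hAC
  have hmem : ∀ p, p ∈ S ↔ p ∈ A.graph := fun p => by rw [← hS]; rfl
  refine (hA.1.sum (normalCone_isMonotone C)).isMaximalMonotone fun z z' h => ?_
  have hrel : ∀ x, ∀ x' ∈ A x, ∀ n ∈ normalCone C x, 0 ≤ (z' - (x' + n)) (z - x) :=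
    fun x x' hx n hn => h x _ ⟨x', hx, n, hn, rfl⟩
  have hrelC : ∀ x, ∀ x' ∈ A x, x ∈ C → 0 ≤ (z' - x') (z - x) := fun x x' hx hxC => by
    simpa using hrel x x' hx 0 ⟨hxC, by simp⟩
  let D : Submodule ℝ X := S.map (LinearMap.fst ℝ X (StrongDual ℝ X))
  have hD : ∀ x, x ∈ D ↔ x ∈ A.dom := by
    intro x
    constructor
    · rintro ⟨p, hp, rfl⟩
      exact ⟨p.2, (hmem p).1 hp⟩
    · rintro ⟨x', hx⟩
      exact ⟨(x, x'), (hmem _).2 hx, rfl⟩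
  have hzD : z ∈ closure (D : Set X) := by
    by_contra hz
    obtain ⟨f, hfD, hfz⟩ := exists_vanishing_functional D hz
    have hfA : ∀ x ∈ A.dom, f x = 0 := fun x hx => hfD x ((hD x).2 hx)
    -- Since `f` vanishes at `x₀`, the pairing is affine in `r` with slope `-f z`; nonnegativity for
    -- both signs of `r` forces `f z = 0`.
    have hline : ∀ r : ℝ, 0 ≤ (z' - x₀') (z - x₀) - r * f z := fun r => by
      have hr := hrelC x₀ (x₀' + r • f)
        (hA.add_mem_of_vanishing (fun x hx => by simp [hfA x hx]) hx₀) (interior_subset hx₀C)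
      have hf0 := hfA x₀ ⟨x₀', hx₀⟩
      simp only [sub_apply, add_apply,
        smul_apply, smul_eq_mul, map_sub, hf0] at hr ⊢
      linarith
    have h1 := nonpos_of_forall_nonneg_sub_mul fun r _ => hline r
    have h2 := nonpos_of_forall_nonneg_sub_mul (b := -f z) fun r _ => by
      simpa using hline (-r)
    exact hfz (by linarith)
  have hzC : z ∈ C := by
    by_contra hz
    obtain ⟨p, hpD, n, hn, hpos⟩ := exists_normalCone_pos hCclosed hCconv D
      ((hD x₀).2 ⟨x₀', hx₀⟩) hx₀C hzD hz
    obtain ⟨p', hp⟩ := (hD p).1 hpD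
    refine absurd (nonpos_of_forall_nonneg_sub_mul (a := (z' - p') (z - p)) fun r hr => ?_)
      (not_le.2 hpos)
    have := hrel p p' hp (r • n) ⟨hn.1, fun c hc => by
      simpa using mul_nonpos_of_nonneg_of_nonpos hr (hn.2 c hc)⟩
    simp only [sub_apply, add_apply,
      smul_apply, smul_eq_mul] at this ⊢
    linarith
  exact mem_sum_normalCone_of_mem hA hS hCconv ((hmem (x₀, x₀')).2 hx₀) hx₀C hzC
    fun p hp hpC => hrelC p.1 p.2 ((hmem p).1 hp) hpC
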